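/- Let $(M,g)$ be a perfect fluid spacetime with torse-forming velocity field, that is: $M$ is a connected smooth $4$-manifold (Hausdorff, second countable), $g$ is a smooth Lorentzian metric of signature $(-,+,+,+)$ with Levi-Civita connection $\nabla$, curvature $R(X,Y)Z=\nabla_X\nabla_YZ-\nabla_Y\nabla_XZ-\nabla_{[X,Y]}Z$, Ricci tensor $S(Y,Z)=\operatorname{tr}(X\mapsto R(X,Y)Z)$ and scalar curvature $r$; $\xi$ is a smooth vector field with $g(\xi,\xi)=-1$ and, with $\eta(X)=g(X,\xi)$, Einstein's equation $$S+\Big(\lambda-\frac r2\Big)g=\kappa\big(\rho\, g+(\sigma+\rho)\,\eta\otimes\eta\big)$$ holds for functions $\rho,\sigma:M\to\mathbb R$ (pressure and energy density) and constants $\lambda,\kappa\in\mathbb R$; and $$\nabla_X\xi=X+\eta(X)\,\xi\qquad\text{for all } X.$$ Let $V$ be a smooth vector field such that $(g,V,\Lambda)$ is a Ricci soliton for some constant $\Lambda\in\mathbb R$, that is, $L_Vg+2S+2\Lambda g=0$, and let $(L_V\nabla)(X,Y)=[V,\nabla_XY]-\nabla_{[V,X]}Y-\nabla_X[V,Y]$.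 Then, on all of $M$, $$(L_V\nabla)(\xi,\xi)=0\qquad\text{and}\qquad \nabla_\xi\nabla_\xi V+R(V,\xi)\xi=0 .$$ Moreover every integral curve $\gamma$ of $\xi$, defined on an open set of parameters, is a smooth geodesic, and $V$ is a Jacobi field along it: $J=V\circ\gamma$ is smooth and satisfies $\frac{D^2J}{dt^2}+R(J,\gamma')\gamma'=0$. -/

import Mathlib

open Bundle VectorField
open scoped Manifold ContDiff Topology

/-- The model space `ℝ⁴`. -/
abbrev R4 : Type := EuclideanSpace ℝ (Fin 4)

/-- The diagonal entries of the Minkowski form of signature `(-,+,+,+)`. -/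
def minkowskiSign (i : Fin 4) : ℝ := if i = 0 then -1 else 1

/-- A smooth Lorentzian metric of signature `(-,+,+,+)` on a smooth 4-manifold. -/
structure LorentzianMetric (M : Type*) [TopologicalSpace M] [ChartedSpace R4 M]
    [IsManifold (𝓡 4) ∞ M] where
  /-- The symmetric bilinear form on each tangent space. -/
  val (x : M) : TangentSpace (𝓡 4) x →L[ℝ] TangentSpace (𝓡 4) x →L[ℝ] ℝ
  symm (x : M) (v w : TangentSpace (𝓡 4) x) : val x v w = val x w v
  signature (x : M) : ∃ b : Module.Basis (Fin 4) ℝ (TangentSpace (𝓡 4) x),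
    ∀ i j, val x (b i) (b j) = if i = j then minkowskiSign i else 0
  contMDiff : ContMDiff (𝓡 4) ((𝓡 4).prod 𝓘(ℝ, R4 →L[ℝ] R4 →L[ℝ] ℝ)) ∞
    (fun x ↦ TotalSpace.mk' (R4 →L[ℝ] R4 →L[ℝ] ℝ) x (val x))

namespace LorentzianMetric

variable {M : Type*} [TopologicalSpace M] [ChartedSpace R4 M] [IsManifold (𝓡 4) ∞ M]

/-- Differentiability of a vector field at a point. -/
abbrev IsDiffAt (X : Π x : M, TangentSpace (𝓡 4) x) (x : M) : Prop :=
  MDifferentiableAt (𝓡 4) ((𝓡 4).prod 𝓘(ℝ, R4))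
    (fun y ↦ TotalSpace.mk' R4 (E := (TangentSpace (𝓡 4) : M → Type)) y (X y)) x

/-! ### Metric pairing of vector fields, orthonormal bases -/

/-- The function `g(X, Y)` of two vector fields. -/
noncomputable def pair (g : LorentzianMetric M) (X Y : Π x : M, TangentSpace (𝓡 4) x) : M → ℝ :=
  fun x ↦ g.val x (X x) (Y x)

/-- A `g`-orthonormal basis of the tangent space at `x`. -/
noncomputable def frame (g : LorentzianMetric M) (x : M) :
    Module.Basis (Fin 4) ℝ (TangentSpace (𝓡 4) x) :=
  (g.signature x).choose

lemma val_frame (g : LorentzianMetric M) (x : M) (i j : Fin 4) :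
    g.val x (g.frame x i) (g.frame x j) = if i = j then minkowskiSign i else 0 :=
  (g.signature x).choose_spec i j

lemma minkowskiSign_mul_self (i : Fin 4) : minkowskiSign i * minkowskiSign i = 1 := by
  unfold minkowskiSign; split_ifs <;> norm_num

lemma val_eq_repr (g : LorentzianMetric M) (x : M) (v : TangentSpace (𝓡 4) x) (i : Fin 4) :
    g.val x v (g.frame x i) = minkowskiSign i * (g.frame x).repr v i := by
  conv_lhs => rw [← (g.frame x).sum_repr v]
  simp only [map_sum, map_smul, sum_apply, smul_apply,
    val_frame, smul_eq_mul, mul_ite, mul_zero, Finset.sum_ite_eq', Finset.mem_univ, if_true]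
  ring

/-- Expansion of a tangent vector in an orthonormal basis. -/
lemma sum_frame (g : LorentzianMetric M) (x : M) (v : TangentSpace (𝓡 4) x) :
    ∑ i, (minkowskiSign i * g.val x v (g.frame x i)) • g.frame x i = v := by
  conv_rhs => rw [← (g.frame x).sum_repr v]
  refine Finset.sum_congr rfl fun i _ ↦ ?_
  rw [val_eq_repr, ← mul_assoc, minkowskiSign_mul_self, one_mul]

/-! ### The Levi-Civita connection -/

lemma mdifferentiableAt_pair (g : LorentzianMetric M) {X Y : Π x : M, TangentSpace (𝓡 4) x}
    {x : M} (hX : IsDiffAt X x) (hY : IsDiffAt Y x) :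
    MDifferentiableAt (𝓡 4) 𝓘(ℝ) (g.pair X Y) x := by
  have h1 : MDifferentiableAt (𝓡 4) ((𝓡 4).prod 𝓘(ℝ))
      (fun m ↦ TotalSpace.mk' ℝ (E := Bundle.Trivial M ℝ) m (g.val m (X m) (Y m))) x := by
    apply MDifferentiableAt.clm_bundle_apply₂ (F₁ := R4) (F₂ := R4)
    · exact g.contMDiff.contMDiffAt.mdifferentiableAt (by simp)
    · exact hX
    · exact hY
  rw [mdifferentiableAt_totalSpace] at h1
  exact h1.2

/-- The right-hand side of the Koszul formula for `2 g(∇_X Y, Z)`. -/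
noncomputable def koszul (g : LorentzianMetric M) (X Y Z : Π x : M, TangentSpace (𝓡 4) x)
    (x : M) : ℝ :=
  mvfderiv (𝓡 4) (g.pair Y Z) x (X x) + mvfderiv (𝓡 4) (g.pair X Z) x (Y x) - mvfderiv (𝓡 4) (g.pair X Y) x (Z x)
    + g.val x (mlieBracket (𝓡 4) X Y x) (Z x)
    - g.val x (mlieBracket (𝓡 4) X Z x) (Y x)
    - g.val x (mlieBracket (𝓡 4) Y Z x) (X x)


lemma koszul_tensorial_right (g : LorentzianMetric M) {X Y : Π x : M, TangentSpace (𝓡 4) x} {x : M}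
    (hX : IsDiffAt X x) (hY : IsDiffAt Y x) :
    TensorialAt (𝓡 4) R4 (fun Z : Π x : M, TangentSpace (𝓡 4) x ↦ g.koszul X Y Z x) x where
  smul {f Z} hf hZ := by
    have h (W : Π x : M, TangentSpace (𝓡 4) x) : g.pair W (f • Z) = f * g.pair W Z := by
      ext y; simp [pair]
    simp only [koszul, h]
    rw [mvfderiv_mul hf (g.mdifferentiableAt_pair hY hZ),
      mvfderiv_mul hf (g.mdifferentiableAt_pair hX hZ),
      mlieBracket_smul_right hf hZ, mlieBracket_smul_right hf hZ]
    simp [pair, g.symm x (Z x)]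
    ring
  add {Z Z'} hZ hZ' := by
    have h (W : Π x : M, TangentSpace (𝓡 4) x) : g.pair W (Z + Z') = g.pair W Z + g.pair W Z' := by
      ext y; simp [pair]
    simp only [koszul, h]
    rw [mvfderiv_add (g.mdifferentiableAt_pair hY hZ) (g.mdifferentiableAt_pair hY hZ'),
      mvfderiv_add (g.mdifferentiableAt_pair hX hZ) (g.mdifferentiableAt_pair hX hZ'),
      mlieBracket_add_right hZ hZ', mlieBracket_add_right hZ hZ']
    simp
    ring

lemma koszul_tensorial_left (g : LorentzianMetric M) {Y Z : Π x : M, TangentSpace (𝓡 4) x} {x : M}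
    (hY : IsDiffAt Y x) (hZ : IsDiffAt Z x) :
    TensorialAt (𝓡 4) R4 (fun X : Π x : M, TangentSpace (𝓡 4) x ↦ g.koszul X Y Z x) x where
  smul {f X} hf hX := by
    have h (W : Π x : M, TangentSpace (𝓡 4) x) : g.pair (f • X) W = f * g.pair X W := by
      ext y; simp [pair]
    simp only [koszul, h]
    rw [mvfderiv_mul hf (g.mdifferentiableAt_pair hX hZ),
      mvfderiv_mul hf (g.mdifferentiableAt_pair hX hY),
      mlieBracket_smul_left hf hX, mlieBracket_smul_left hf hX]
    simp [pair]
    ring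
  add {X X'} hX hX' := by
    have h (W : Π x : M, TangentSpace (𝓡 4) x) : g.pair (X + X') W = g.pair X W + g.pair X' W := by
      ext y; simp [pair]
    simp only [koszul, h]
    rw [mvfderiv_add (g.mdifferentiableAt_pair hX hZ) (g.mdifferentiableAt_pair hX' hZ),
      mvfderiv_add (g.mdifferentiableAt_pair hX hY) (g.mdifferentiableAt_pair hX' hY),
      mlieBracket_add_left hX hX', mlieBracket_add_left hX hX']
    simp
    ring

lemma koszul_add_mid (g : LorentzianMetric M) {X Y Y' Z : Π x : M, TangentSpace (𝓡 4) x} {x : M}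
    (hX : IsDiffAt X x) (hY : IsDiffAt Y x) (hY' : IsDiffAt Y' x) (hZ : IsDiffAt Z x) :
    g.koszul X (Y + Y') Z x = g.koszul X Y Z x + g.koszul X Y' Z x := by
  have h (W : Π x : M, TangentSpace (𝓡 4) x) : g.pair (Y + Y') W = g.pair Y W + g.pair Y' W := by
    ext y; simp [pair]
  have h' (W : Π x : M, TangentSpace (𝓡 4) x) : g.pair W (Y + Y') = g.pair W Y + g.pair W Y' := by
    ext y; simp [pair]
  simp only [koszul, h, h']
  rw [mvfderiv_add (g.mdifferentiableAt_pair hY hZ) (g.mdifferentiableAt_pair hY' hZ),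
    mvfderiv_add (g.mdifferentiableAt_pair hX hY) (g.mdifferentiableAt_pair hX hY'),
    mlieBracket_add_left hY hY', mlieBracket_add_right hY hY']
  simp
  ring

lemma koszul_smul_mid (g : LorentzianMetric M) {X Y Z : Π x : M, TangentSpace (𝓡 4) x} {f : M → ℝ}
    {x : M} (hX : IsDiffAt X x) (hY : IsDiffAt Y x) (hf : MDifferentiableAt (𝓡 4) 𝓘(ℝ) f x)
    (hZ : IsDiffAt Z x) :
    g.koszul X (f • Y) Z x =
      f x * g.koszul X Y Z x + 2 * (mvfderiv (𝓡 4) f x (X x) * g.val x (Y x) (Z x)) := by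
  have h (W : Π x : M, TangentSpace (𝓡 4) x) : g.pair (f • Y) W = f * g.pair Y W := by
    ext y; simp [pair]
  have h' (W : Π x : M, TangentSpace (𝓡 4) x) : g.pair W (f • Y) = f * g.pair W Y := by
    ext y; simp [pair]
  simp only [koszul, h, h']
  rw [mvfderiv_mul hf (g.mdifferentiableAt_pair hY hZ),
    mvfderiv_mul hf (g.mdifferentiableAt_pair hX hY),
    mlieBracket_smul_left hf hY, mlieBracket_smul_right hf hY]
  simp [pair, g.symm x (Y x) (X x)]
  ring

/-- For a vector field `Y` differentiable at `x`, the bilinear form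
`(w, u) ↦ 2 g(∇_u Y, w)` on the tangent space at `x`. -/
noncomputable def koszulForm (g : LorentzianMetric M) {Y : Π x : M, TangentSpace (𝓡 4) x} {x : M}
    (hY : IsDiffAt Y x) :
    TangentSpace (𝓡 4) x →L[ℝ] TangentSpace (𝓡 4) x →L[ℝ] ℝ :=
  TensorialAt.mkHom₂ (I := 𝓡 4) (F := R4) (F' := R4) (fun Z X ↦ g.koszul X Y Z x) x
    (fun _ hX ↦ g.koszul_tensorial_right hX hY) (fun _ hZ ↦ g.koszul_tensorial_left hY hZ)

open Classical in
/-- `∇_u Y` at `x`, as a function of `u`: the vector whose `g`-product with every `w` is half of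
the Koszul form. (Value `0` if `Y` is not differentiable at `x`.) -/
noncomputable def nablaFun (g : LorentzianMetric M) (Y : Π x : M, TangentSpace (𝓡 4) x) (x : M) :
    TangentSpace (𝓡 4) x →L[ℝ] TangentSpace (𝓡 4) x :=
  if hY : IsDiffAt Y x then
    ∑ i, ((minkowskiSign i / 2) • g.koszulForm hY (g.frame x i)).smulRight (g.frame x i)
  else 0

lemma koszulForm_apply_extend (g : LorentzianMetric M) {Y : Π x : M, TangentSpace (𝓡 4) x} {x : M}
    (hY : IsDiffAt Y x) (u w : TangentSpace (𝓡 4) x) :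
    g.koszulForm hY w u =
      g.koszul (FiberBundle.extend R4 u) Y (FiberBundle.extend R4 w) x := rfl

/-- The Levi-Civita connection of `g`, given by the Koszul formula. -/
noncomputable def leviCivita (g : LorentzianMetric M) :
    CovariantDerivative (𝓡 4) R4 (TangentSpace (𝓡 4) : M → Type) where
  toFun := g.nablaFun
  isCovariantDerivativeOnUniv :=
    { add := by
        intro Y Y' x hY hY' _
        have hs : IsDiffAt (Y + Y') x := mdifferentiableAt_add_section hY hY'
        ext1 u
        have key (w : TangentSpace (𝓡 4) x) : g.koszulForm hs w u =
            g.koszulForm hY w u + g.koszulForm hY' w u :=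
          g.koszul_add_mid (FiberBundle.mdifferentiableAt_extend ..) hY hY' (FiberBundle.mdifferentiableAt_extend ..)
        simp only [nablaFun, dif_pos hs, dif_pos hY, dif_pos hY']
        simp [key, mul_add, add_smul, Finset.sum_add_distrib]
      leibniz := by
        intro Y f x hY hf _
        have hs : IsDiffAt (f • Y) x := hf.smul_section hY
        ext1 u
        have key (w : TangentSpace (𝓡 4) x) : g.koszulForm hs w u =
            f x * g.koszulForm hY w u + 2 * (mvfderiv (𝓡 4) f x u * g.val x (Y x) w) := by
          have := g.koszul_smul_mid (f := f) (X := FiberBundle.extend R4 u)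
            (Z := FiberBundle.extend R4 w) (FiberBundle.mdifferentiableAt_extend ..) hY hf
            (FiberBundle.mdifferentiableAt_extend ..)
          simpa [koszulForm_apply_extend] using this
        simp only [nablaFun, dif_pos hs, dif_pos hY]
        simp only [sum_apply, ContinuousLinearMap.smulRight_apply, smul_apply,
          key, smul_eq_mul, add_apply]
        conv_rhs => rw [← g.sum_frame x (Y x)]
        rw [Finset.smul_sum, Finset.smul_sum, ← Finset.sum_add_distrib]
        refine Finset.sum_congr rfl fun i _ ↦ ?_
        rw [smul_smul, smul_smul, ← add_smul]
        congr 1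
        ring }

lemma val_leviCivita (g : LorentzianMetric M) {X Y Z : Π x : M, TangentSpace (𝓡 4) x} {x : M}
    (hX : IsDiffAt X x) (hY : IsDiffAt Y x) (hZ : IsDiffAt Z x) :
    2 * g.val x (g.leviCivita Y x (X x)) (Z x) = g.koszul X Y Z x := by
  have h : g.koszulForm hY (Z x) (X x) = g.koszul X Y Z x :=
    TensorialAt.mkHom₂_apply _ _ hZ hX
  rw [← h]
  change 2 * g.val x (g.nablaFun Y x (X x)) (Z x) = _
  conv_rhs => rw [← g.sum_frame x (Z x)]
  simp only [nablaFun, dif_pos hY]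
  simp only [sum_apply, ContinuousLinearMap.smulRight_apply, smul_apply, map_sum, map_smul,
    smul_eq_mul, Finset.mul_sum, g.symm x (Z x)]
  refine Finset.sum_congr rfl fun i _ ↦ ?_
  ring

/-- The Levi-Civita connection is torsion-free and compatible with the metric. -/
lemma leviCivita_spec (g : LorentzianMetric M) {X Y Z : Π x : M, TangentSpace (𝓡 4) x} {x : M}
    (hX : IsDiffAt X x) (hY : IsDiffAt Y x) (hZ : IsDiffAt Z x) :
    g.leviCivita Y x (X x) - g.leviCivita X x (Y x) = mlieBracket (𝓡 4) X Y x ∧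
    mvfderiv (𝓡 4) (g.pair Y Z) x (X x) =
      g.val x (g.leviCivita Y x (X x)) (Z x) + g.val x (Y x) (g.leviCivita Z x (X x)) := by
  have hsymm (A B : Π x : M, TangentSpace (𝓡 4) x) : g.pair A B = g.pair B A :=
    funext fun y ↦ g.symm y _ _
  constructor
  · rw [← g.sum_frame x (_ - _), ← g.sum_frame x (mlieBracket (𝓡 4) X Y x)]
    refine Finset.sum_congr rfl fun i _ ↦ ?_
    congr 2
    have hW : IsDiffAt (FiberBundle.extend R4 (g.frame x i)) x :=
      FiberBundle.mdifferentiableAt_extend ..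
    have h1 := g.val_leviCivita hX hY hW
    have h2 := g.val_leviCivita hY hX hW
    rw [FiberBundle.extend_apply_self] at h1 h2
    simp only [koszul, FiberBundle.extend_apply_self] at h1 h2
    rw [mlieBracket_swap_apply (V := Y) (W := X), hsymm Y X] at h2
    simp only [map_sub, map_neg, sub_apply, neg_apply] at h1 h2 ⊢
    linarith
  · have h1 := g.val_leviCivita hX hY hZ
    have h2 := g.val_leviCivita hX hZ hY
    simp only [koszul] at h1 h2
    rw [mlieBracket_swap_apply (V := Z) (W := Y), hsymm Z Y] at h2
    rw [g.symm x (Y x)]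
    simp only [map_neg, neg_apply] at h1 h2
    linarith

/-- The vector field `∇_X Y`. -/
noncomputable def nabla (g : LorentzianMetric M) (X Y : Π x : M, TangentSpace (𝓡 4) x) :
    Π x : M, TangentSpace (𝓡 4) x :=
  fun x ↦ g.leviCivita Y x (X x)

/-! ### Curvature -/

/-- The vector field `R(X,Y)Z = ∇_X ∇_Y Z - ∇_Y ∇_X Z - ∇_{[X,Y]} Z`. -/
noncomputable def curvature (g : LorentzianMetric M) (X Y Z : Π x : M, TangentSpace (𝓡 4) x) :
    Π x : M, TangentSpace (𝓡 4) x :=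
  g.nabla X (g.nabla Y Z) - g.nabla Y (g.nabla X Z) - g.nabla (mlieBracket (𝓡 4) X Y) Z

/-- The Riemann curvature tensor `R(u,v)w` on tangent vectors at `x`, computed with vector fields
extending `u`, `v`, `w` smoothly near `x`. -/
noncomputable def riemann (g : LorentzianMetric M) (x : M) (u v w : TangentSpace (𝓡 4) x) :
    TangentSpace (𝓡 4) x :=
  g.curvature (FiberBundle.extend R4 u) (FiberBundle.extend R4 v) (FiberBundle.extend R4 w) x

/-- The Ricci tensor `S(v,w)`, the trace of `u ↦ R(u,v)w`. -/
noncomputable def ricci (g : LorentzianMetric M) (x : M) (v w : TangentSpace (𝓡 4) x) : ℝ :=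
  ∑ i, (g.frame x).repr (g.riemann x (g.frame x i) v w) i

/-- The scalar curvature, the `g`-trace of the Ricci tensor. -/
noncomputable def scalarCurvature (g : LorentzianMetric M) (x : M) : ℝ :=
  ∑ i, minkowskiSign i * g.ricci x (g.frame x i) (g.frame x i)

/-! ### Lie derivatives along a vector field -/

/-- `(L_V g)(X,Y) = V(g(X,Y)) - g([V,X],Y) - g(X,[V,Y])`. -/
noncomputable def lieDerivMetric (g : LorentzianMetric M)
    (V X Y : Π x : M, TangentSpace (𝓡 4) x) (x : M) : ℝ :=
  mvfderiv (𝓡 4) (g.pair X Y) x (V x) - g.val x (mlieBracket (𝓡 4) V X x) (Y x)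
    - g.val x (X x) (mlieBracket (𝓡 4) V Y x)

/-- `(L_V ∇)(X,Y) = [V, ∇_X Y] - ∇_{[V,X]} Y - ∇_X [V,Y]`. -/
noncomputable def lieDerivConnection (g : LorentzianMetric M)
    (V X Y : Π x : M, TangentSpace (𝓡 4) x) : Π x : M, TangentSpace (𝓡 4) x :=
  mlieBracket (𝓡 4) V (g.nabla X Y) - g.nabla (mlieBracket (𝓡 4) V X) Y
    - g.nabla X (mlieBracket (𝓡 4) V Y)

/-! ### Perfect fluids, torse-forming fields, Ricci solitons -/

/-- Smoothness of a vector field. -/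
def IsSmoothField (X : Π x : M, TangentSpace (𝓡 4) x) : Prop :=
  ContMDiff (𝓡 4) ((𝓡 4).prod 𝓘(ℝ, R4)) ∞
    (fun y ↦ TotalSpace.mk' R4 (E := (TangentSpace (𝓡 4) : M → Type)) y (X y))

/-- The energy-momentum tensor `T = ρ g + (σ + ρ) η ⊗ η` of a perfect fluid with pressure `ρ`,
energy density `σ` and velocity field `ξ`, where `η = g(·, ξ)`. -/
noncomputable def fluidTensor (g : LorentzianMetric M) (ξ : Π x : M, TangentSpace (𝓡 4) x)
    (ρ σ : M → ℝ) (x : M) (u v : TangentSpace (𝓡 4) x) : ℝ :=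
  ρ x * g.val x u v + (σ x + ρ x) * (g.val x u (ξ x) * g.val x v (ξ x))

/-- `(M, g)` is a perfect fluid spacetime: the velocity field `ξ` satisfies `g(ξ,ξ) = -1`, and
Einstein's equation `S + (lam - r/2) g = κ T` with cosmological constant `lam` and gravitational
constant `κ` holds for the perfect fluid tensor `T`. -/
def IsPerfectFluid (g : LorentzianMetric M) (ξ : Π x : M, TangentSpace (𝓡 4) x)
    (ρ σ : M → ℝ) (lam κ : ℝ) : Prop :=
  (∀ x, g.val x (ξ x) (ξ x) = -1) ∧
  ∀ x u v, g.ricci x u v + (lam - g.scalarCurvature x / 2) * g.val x u v =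
    κ * g.fluidTensor ξ ρ σ x u v

/-- `ξ` is torse-forming: `∇_u ξ = u + η(u) ξ` for every tangent vector `u`. -/
def IsTorseForming (g : LorentzianMetric M) (ξ : Π x : M, TangentSpace (𝓡 4) x) : Prop :=
  ∀ x (u : TangentSpace (𝓡 4) x), g.leviCivita ξ x u = u + g.val x u (ξ x) • ξ x

/-- `(g, V, Λ)` is a Ricci soliton: `L_V g + 2 S + 2 Λ g = 0`. -/
def IsRicciSoliton (g : LorentzianMetric M) (V : Π x : M, TangentSpace (𝓡 4) x) (Λ : ℝ) : Prop :=
  ∀ (X Y : Π x : M, TangentSpace (𝓡 4) x) (x : M), IsDiffAt X x → IsDiffAt Y x →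
    g.lieDerivMetric V X Y x + 2 * g.ricci x (X x) (Y x) + 2 * Λ * g.val x (X x) (Y x) = 0

/-! ### Geodesics and Jacobi fields -/

/-- The velocity `γ'(t)` of a curve. -/
noncomputable def velocity (γ : ℝ → M) (t : ℝ) : TangentSpace (𝓡 4) (γ t) :=
  mfderiv 𝓘(ℝ, ℝ) (𝓡 4) γ t (1 : ℝ)

/-- The covariant derivative `DJ/dt` of a vector field `J` along a curve `γ`, at time `t`. Writing
`J = ∑ J^k E_k(γ)` in the coordinate frame `E_k` given by the trivialization of the tangent bundle
at `γ t`, it is `∑ (J^k)'(t) E_k + ∑ J^k(t) ∇_{γ'(t)} E_k`; the vector field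
`∑ J^k(t) E_k` with constant coefficients is `FiberBundle.extend R4 (J t)`. -/
noncomputable def covDerivAlong (g : LorentzianMetric M) (γ : ℝ → M)
    (J : Π t : ℝ, TangentSpace (𝓡 4) (γ t)) (t : ℝ) : TangentSpace (𝓡 4) (γ t) :=
  (trivializationAt R4 (TangentSpace (𝓡 4) : M → Type) (γ t)).symm (γ t)
      (deriv (fun s ↦ (trivializationAt R4 (TangentSpace (𝓡 4) : M → Type) (γ t)
        (TotalSpace.mk' R4 (γ s) (J s))).2) t)
    + g.leviCivita (FiberBundle.extend R4 (J t)) (γ t) (velocity γ t)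

/-- `γ` is a (smooth, affinely parametrized) geodesic on `s`: `Dγ'/dt = 0`. -/
def IsGeodesicOn (g : LorentzianMetric M) (γ : ℝ → M) (s : Set ℝ) : Prop :=
  ContMDiffOn 𝓘(ℝ, ℝ) (𝓡 4) ∞ γ s ∧ ∀ t ∈ s, g.covDerivAlong γ (velocity γ) t = 0

/-- `J` is a (smooth) Jacobi field along `γ` on `s`: `D²J/dt² + R(J, γ')γ' = 0`. -/
def IsJacobiFieldOn (g : LorentzianMetric M) (γ : ℝ → M)
    (J : Π t : ℝ, TangentSpace (𝓡 4) (γ t)) (s : Set ℝ) : Prop :=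
  ContMDiffOn 𝓘(ℝ, ℝ) ((𝓡 4).prod 𝓘(ℝ, R4)) ∞
    (fun t ↦ TotalSpace.mk' R4 (E := (TangentSpace (𝓡 4) : M → Type)) (γ t) (J t)) s ∧
  ∀ t ∈ s, g.covDerivAlong γ (g.covDerivAlong γ J) t
    + g.riemann (γ t) (J t) (velocity γ t) (velocity γ t) = 0

end LorentzianMetric

/-! Write `η = g(·, ξ)` and `φ = g(V, ξ)`. Expanding the curvature with `∇_X ξ = X + η(X)ξ` gives
`R(X,Y)ξ = η(Y)X - η(X)Y` (`IsTorseForming.curvature_eq`), hence `S(·, ξ) = 3η`. The soliton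
equation with one slot equal to `ξ` then contains no unknown curvature and reads `∇_ξ V = -(6+2Λ)ξ -
grad φ + V + φξ` (`IsRicciSoliton.val_nabla_eq`). Its `ξ`-component gives `ξφ = 3 + Λ`, a constant.

Differentiate this once more along `ξ`, where `∇_ξ ξ = 0`. Since `ξφ` is constant, commuting `ξ`
with a field `Z` gives `∇_ξ grad φ = -grad φ - (3+Λ)ξ`, and everything collapses to `∇_ξ ∇_ξ V = V +
φξ` (`IsRicciSoliton.nabla_nabla_eq`). This is `-R(V,ξ)ξ`, which is the Jacobi equation. The same
identity, with `[V,ξ] = V + φξ - ∇_ξ V`, makes the two surviving terms of `(L_V ∇)(ξ,ξ)` cancel.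

Two analytic points support the computation: `∇_X Y` is smooth for smooth `X`, `Y`
(`IsSmoothAt.nabla`), so it can be differentiated again; and the curvature at a point sees only the
value of its last argument (`curvature_congr_right`), so the tensor defined by extensions can be
evaluated on the field `ξ`. For the curve statements, `D/dt` of a restricted field is `∇` in the
direction of the velocity (`covDerivAlong_comp`). -/

namespace LorentzianMetric

variable {M : Type*} [TopologicalSpace M] [ChartedSpace R4 M] [IsManifold (𝓡 4) ∞ M]

/-! ### Smoothness of brackets, derivatives and the Levi-Civita connection. -/

/-- Smoothness of a vector field at a point. -/
abbrev IsSmoothAt (X : Π x : M, TangentSpace (𝓡 4) x) (x : M) : Prop :=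
  ContMDiffAt (𝓡 4) ((𝓡 4).prod 𝓘(ℝ, R4)) ∞
    (fun y ↦ TotalSpace.mk' R4 (E := (TangentSpace (𝓡 4) : M → Type)) y (X y)) x

variable {X Y Z W : Π x : M, TangentSpace (𝓡 4) x} {x : M}

lemma IsSmoothAt.isDiffAt (hX : IsSmoothAt X x) : IsDiffAt X x :=
  ContMDiffAt.mdifferentiableAt hX (by simp)

lemma IsSmoothAt.eventually_isDiffAt (hX : IsSmoothAt X x) : ∀ᶠ y in 𝓝 x, IsDiffAt X y := by
  have h := (contMDiffAt_iff_contMDiffAt_nhds (n := 1) (by simp)).1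
    (ContMDiffAt.of_le hX (by simp))
  exact h.mono fun y hy ↦ hy.mdifferentiableAt (by simp)

lemma isSmoothAt_extend (v : TangentSpace (𝓡 4) x) : IsSmoothAt (FiberBundle.extend R4 v) x :=
  FiberBundle.contMDiffAt_extend ..

lemma IsSmoothAt.add (hX : IsSmoothAt X x) (hY : IsSmoothAt Y x) : IsSmoothAt (X + Y) x :=
  ContMDiffAt.add_section hX hY

lemma IsSmoothAt.smul {f : M → ℝ} (hf : ContMDiffAt (𝓡 4) 𝓘(ℝ) ∞ f x) (hX : IsSmoothAt X x) :
    IsSmoothAt (f • X) x :=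
  ContMDiffAt.smul_section hf hX

lemma IsSmoothAt.mlieBracket (hX : IsSmoothAt X x) (hY : IsSmoothAt Y x) :
    IsSmoothAt (mlieBracket (𝓡 4) X Y) x :=
  have : IsManifold (𝓡 4) (minSmoothness ℝ 2) M := by
    rw [minSmoothness_of_isRCLikeNormedField]; infer_instance
  have : IsManifold (𝓡 4) (minSmoothness ℝ 3) M := by
    rw [minSmoothness_of_isRCLikeNormedField]; infer_instance
  have : IsManifold (𝓡 4) ((⊤ : ℕ∞) + 1) M := ‹IsManifold (𝓡 4) ∞ M›
  ContMDiffAt.mlieBracket_vectorField (m := ⊤) (n := ⊤) hX hY (by simp)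

lemma IsSmoothAt.mvfderiv_apply {f : M → ℝ} (hf : ContMDiffAt (𝓡 4) 𝓘(ℝ) ∞ f x)
    (hX : IsSmoothAt X x) :
    ContMDiffAt (𝓡 4) 𝓘(ℝ) ∞ (fun y ↦ mvfderiv (𝓡 4) f y (X y)) x := by
  have h1 := ContMDiffAt.mfderiv_const (m := ∞) hf (by simp)
  have h2 := ContMDiffAt.clm_apply_of_inCoordinates (b₁ := id) (b₂ := f) (F₁ := R4) (F₂ := ℝ)
    (E₁ := (TangentSpace (𝓡 4) : M → Type)) (E₂ := (TangentSpace 𝓘(ℝ, ℝ) : ℝ → Type))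
    (v := fun y ↦ X y) h1 hX hf
  rw [contMDiffAt_totalSpace] at h2
  -- The tangent bundle of the model space `ℝ` is trivialized by the identity, so the fibre
  -- component is the derivative itself.
  refine h2.2.congr_of_eventuallyEq (.of_forall fun y ↦ ?_)
  exact (congrArg Prod.snd (trivializationAt_model_space_apply (I := 𝓘(ℝ, ℝ))
    (TotalSpace.mk (f y) (mfderiv (𝓡 4) 𝓘(ℝ) f y (X y))) (f x))).symm

variable (g : LorentzianMetric M)

lemma contMDiffAt_pair (hX : IsSmoothAt X x) (hY : IsSmoothAt Y x) :
    ContMDiffAt (𝓡 4) 𝓘(ℝ) ∞ (g.pair X Y) x := by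
  have h1 : ContMDiffAt (𝓡 4) ((𝓡 4).prod 𝓘(ℝ)) ∞
      (fun m ↦ TotalSpace.mk' ℝ (E := Bundle.Trivial M ℝ) m (g.val m (X m) (Y m))) x := by
    apply ContMDiffAt.clm_bundle_apply₂ (F₁ := R4) (F₂ := R4)
    · exact g.contMDiff.contMDiffAt
    · exact hX
    · exact hY
  rw [contMDiffAt_totalSpace] at h1
  exact h1.2

lemma contMDiffAt_koszul (hX : IsSmoothAt X x) (hY : IsSmoothAt Y x) (hZ : IsSmoothAt Z x) :
    ContMDiffAt (𝓡 4) 𝓘(ℝ) ∞ (g.koszul X Y Z) x := by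
  unfold koszul
  exact (((((IsSmoothAt.mvfderiv_apply (g.contMDiffAt_pair hY hZ) hX).add
    (IsSmoothAt.mvfderiv_apply (g.contMDiffAt_pair hX hZ) hY)).sub
    (IsSmoothAt.mvfderiv_apply (g.contMDiffAt_pair hX hY) hZ)).add
    (g.contMDiffAt_pair (hX.mlieBracket hY) hZ)).sub
    (g.contMDiffAt_pair (hX.mlieBracket hZ) hY)).sub
    (g.contMDiffAt_pair (hY.mlieBracket hZ) hX)

lemma eq_of_forall_val_eq {u v : TangentSpace (𝓡 4) x}
    (h : ∀ w, g.val x u w = g.val x v w) : u = v := by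
  rw [← g.sum_frame x u, ← g.sum_frame x v]
  simp only [h]

/-- The coordinate fields of the trivialization of the tangent bundle at `x`. -/
noncomputable def coordField (x : M) (i : Fin 4) : Π y : M, TangentSpace (𝓡 4) y :=
  FiberBundle.extend R4 ((trivializationAt R4 (TangentSpace (𝓡 4) : M → Type) x).symm x
    (EuclideanSpace.single i 1))

lemma symmL_eq_sum_coordField {y : M}
    (hy : y ∈ (trivializationAt R4 (TangentSpace (𝓡 4) : M → Type) x).baseSet) (a : R4) :
    (trivializationAt R4 (TangentSpace (𝓡 4) : M → Type) x).symmL ℝ y a =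
      ∑ i, a i • coordField x i y := by
  let t := trivializationAt R4 (TangentSpace (𝓡 4) : M → Type) x
  have hx : x ∈ t.baseSet := FiberBundle.mem_baseSet_trivializationAt' x
  have h i : coordField x i y = t.symmL ℝ y (EuclideanSpace.single i 1) := by
    change t.symm y (t ⟨x, t.symm x (EuclideanSpace.single i 1)⟩).2 = _
    rw [t.apply_mk_symm hx, t.symmL_apply hy]
  have ha : a = ∑ i, a i • EuclideanSpace.single i (1 : ℝ) := by
    simpa using ((EuclideanSpace.basisFun (Fin 4) ℝ).sum_repr a).symm
  conv_lhs => rw [ha]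
  simp only [map_sum, map_smul, h, t]

/-- A vector field is smooth at a point once its products with all smooth fields are. -/
lemma isSmoothAt_of_pair
    (h : ∀ Z : Π x : M, TangentSpace (𝓡 4) x, IsSmoothAt Z x →
      ContMDiffAt (𝓡 4) 𝓘(ℝ) ∞ (g.pair W Z) x) : IsSmoothAt W x := by
  let t := trivializationAt R4 (TangentSpace (𝓡 4) : M → Type) x
  have hx : x ∈ t.baseSet := FiberBundle.mem_baseSet_trivializationAt' x
  let E := coordField x
  have hE i : IsSmoothAt (E i) x := isSmoothAt_extend _
  have hEy {y : M} (hy : y ∈ t.baseSet) (a : R4) : t.symmL ℝ y a = ∑ i, a i • E i y :=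
    symmL_eq_sum_coordField hy a
  -- `G` is the Gram operator of the coordinate frame and `β` the covector of products of `W` with
  -- it; the components of `W` solve `G a = β`, so they are `G⁻¹ β`.
  let B : Fin 4 → Fin 4 → R4 →L[ℝ] R4 →L[ℝ] ℝ := fun i j ↦
    (EuclideanSpace.proj i : R4 →L[ℝ] ℝ).smulRight (EuclideanSpace.proj j : R4 →L[ℝ] ℝ)
  let G : M → R4 →L[ℝ] R4 →L[ℝ] ℝ := fun y ↦ ∑ i, ∑ j, g.pair (E i) (E j) y • B i j
  let β : M → R4 →L[ℝ] ℝ := fun y ↦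
    ∑ i, g.pair W (E i) y • (EuclideanSpace.proj i : R4 →L[ℝ] ℝ)
  have hG : ContMDiffAt (𝓡 4) 𝓘(ℝ, R4 →L[ℝ] R4 →L[ℝ] ℝ) ∞ G x :=
    ContMDiffAt.sum fun i _ ↦ ContMDiffAt.sum fun j _ ↦
      (g.contMDiffAt_pair (hE i) (hE j)).smul contMDiffAt_const
  have hβ : ContMDiffAt (𝓡 4) 𝓘(ℝ, R4 →L[ℝ] ℝ) ∞ β x :=
    ContMDiffAt.sum fun i _ ↦ (h _ (hE i)).smul contMDiffAt_const
  have hGval {y : M} (hy : y ∈ t.baseSet) (a b : R4) :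
      G y a b = g.val y (t.symmL ℝ y a) (t.symmL ℝ y b) := by
    simp only [hEy hy a, hEy hy b, map_sum, map_smul, sum_apply, smul_apply, G, B, pair,
      ContinuousLinearMap.smulRight_apply, smul_eq_mul, PiLp.proj_apply, Finset.mul_sum]
    rw [Finset.sum_comm]
    exact Finset.sum_congr rfl fun j _ ↦ Finset.sum_congr rfl fun i _ ↦ by ring
  have hGβ {y : M} (hy : y ∈ t.baseSet) : G y (t ⟨y, W y⟩).2 = β y := by
    ext b
    have h1 : t.symmL ℝ y (t ⟨y, W y⟩).2 = W y := by
      rw [t.symmL_apply hy, t.symm_apply_apply_mk hy]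
    rw [hGval hy, h1, hEy hy b]
    simp only [map_sum, map_smul, smul_eq_mul, β, pair, sum_apply, smul_apply, PiLp.proj_apply,
      mul_comm]
  -- Nondegeneracy of the metric at `x`; equality of dimensions then makes `G x` invertible, and
  -- inversion is smooth near an invertible operator.
  have hinj : Function.Injective (G x) := by
    intro a a' haa
    have h1 : t.symmL ℝ x a = t.symmL ℝ x a' := g.eq_of_forall_val_eq fun w ↦ by
      have h2 : t.symmL ℝ x (t ⟨x, w⟩).2 = w := by
        rw [t.symmL_apply hx, t.symm_apply_apply_mk hx]
      rw [← h2, ← hGval hx, ← hGval hx, haa]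
    have h3 (b : R4) : (t ⟨x, t.symmL ℝ x b⟩).2 = b := by
      rw [t.symmL_apply hx, t.apply_mk_symm hx]
    rw [← h3 a, ← h3 a', h1]
  have hfin : Module.finrank ℝ R4 = Module.finrank ℝ (R4 →L[ℝ] ℝ) := by
    rw [← (LinearMap.toContinuousLinearMap (𝕜 := ℝ) (E := R4) (F' := ℝ)).finrank_eq,
      Module.finrank_linearMap]
    simp
  let Ge : R4 ≃L[ℝ] R4 →L[ℝ] ℝ :=
    (LinearMap.linearEquivOfInjective (G x : R4 →ₗ[ℝ] R4 →L[ℝ] ℝ) hinj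
      hfin).toContinuousLinearEquiv
  have hGe : (Ge : R4 →L[ℝ] R4 →L[ℝ] ℝ) = G x := by ext; rfl
  have hinv : ContMDiffAt (𝓡 4) 𝓘(ℝ, (R4 →L[ℝ] ℝ) →L[ℝ] R4) ∞
      (fun y ↦ (G y).inverse) x := by
    have h1 := contDiffAt_map_inverse (n := ∞) Ge
    rw [hGe] at h1
    exact h1.contMDiffAt.comp x hG
  have hev : ∀ᶠ y in 𝓝 x, (G y).IsInvertible := by
    have h1 := Ge.nhds
    rw [hGe] at h1
    filter_upwards [hG.continuousAt.preimage_mem_nhds h1] with y hy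
    exact hy
  rw [IsSmoothAt, contMDiffAt_section]
  refine (hinv.clm_apply hβ).congr_of_eventuallyEq ?_
  filter_upwards [hev, t.open_baseSet.mem_nhds hx] with y hy hyt
  rw [← hGβ hyt, hy.inverse_apply_self]

/-- The connection is defined pointwise, so smoothness is read off its products with smooth fields,
which near `x` are half the Koszul expression. -/
lemma IsSmoothAt.nabla (hX : IsSmoothAt X x) (hY : IsSmoothAt Y x) :
    IsSmoothAt (g.nabla X Y) x := by
  refine g.isSmoothAt_of_pair fun Z hZ ↦ ?_
  have h1 : ContMDiffAt (𝓡 4) 𝓘(ℝ) ∞ (fun y ↦ (1 / 2 : ℝ) * g.koszul X Y Z y) x :=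
    contMDiffAt_const.mul (g.contMDiffAt_koszul hX hY hZ)
  refine h1.congr_of_eventuallyEq ?_
  filter_upwards [hX.eventually_isDiffAt, hY.eventually_isDiffAt, hZ.eventually_isDiffAt]
    with y h1 h2 h3
  rw [← g.val_leviCivita h1 h2 h3]
  simp [pair, LorentzianMetric.nabla]

end LorentzianMetric

/-! ### Brackets as commutators of derivations, and tensoriality of the curvature in its last slot.
-/

namespace LorentzianMetric

variable {M : Type*} [TopologicalSpace M] [ChartedSpace R4 M] [IsManifold (𝓡 4) ∞ M]
variable {X Y Z W : Π x : M, TangentSpace (𝓡 4) x} {x : M}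

lemma leibniz_mlieBracket (hX : IsSmoothAt X x) (hY : IsSmoothAt Y x) (hZ : IsSmoothAt Z x) :
    mlieBracket (𝓡 4) X (mlieBracket (𝓡 4) Y Z) x =
      mlieBracket (𝓡 4) (mlieBracket (𝓡 4) X Y) Z x +
        mlieBracket (𝓡 4) Y (mlieBracket (𝓡 4) X Z) x := by
  have : IsManifold (𝓡 4) (minSmoothness ℝ 3) M := by
    rw [minSmoothness_of_isRCLikeNormedField]; infer_instance
  have h : minSmoothness ℝ 2 ≤ ∞ := by
    rw [minSmoothness_of_isRCLikeNormedField]; exact WithTop.coe_le_coe.2 le_top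
  exact leibniz_identity_mlieBracket_apply (ContMDiffAt.of_le hX h) (ContMDiffAt.of_le hY h)
    (ContMDiffAt.of_le hZ h)

omit [IsManifold (𝓡 4) ∞ M] in
lemma mvfderiv_congr {f f' : M → ℝ} (h : f =ᶠ[𝓝 x] f') :
    mvfderiv (𝓡 4) f x = mvfderiv (𝓡 4) f' x := by
  ext u
  exact congrArg (fun L : TangentSpace (𝓡 4) x →L[ℝ] ℝ ↦ L u) h.mfderiv_eq

/-- Leibniz rule applied twice. Its use is to isolate the second derivative of `f` as a coefficient
of `Z x` in the Jacobi identity. -/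
lemma mlieBracket_mlieBracket_smul {f : M → ℝ} (hf : ContMDiffAt (𝓡 4) 𝓘(ℝ) ∞ f x)
    (hY : IsSmoothAt Y x) (hZ : IsSmoothAt Z x) :
    mlieBracket (𝓡 4) X (mlieBracket (𝓡 4) Y (f • Z)) x =
      (mvfderiv (𝓡 4) (fun y ↦ mvfderiv (𝓡 4) f y (Y y)) x (X x) • Z x +
        mvfderiv (𝓡 4) f x (Y x) • mlieBracket (𝓡 4) X Z x) +
      (mvfderiv (𝓡 4) f x (X x) • mlieBracket (𝓡 4) Y Z x +
        f x • mlieBracket (𝓡 4) X (mlieBracket (𝓡 4) Y Z) x) := by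
  have hf' : ∀ᶠ y in 𝓝 x, MDifferentiableAt (𝓡 4) 𝓘(ℝ) f y :=
    ((contMDiffAt_iff_contMDiffAt_nhds (n := 1) (by simp)).1 (hf.of_le (by simp))).mono
      fun y hy ↦ hy.mdifferentiableAt (by simp)
  have h : mlieBracket (𝓡 4) Y (f • Z) =ᶠ[𝓝 x]
      (fun y ↦ mvfderiv (𝓡 4) f y (Y y)) • Z + f • mlieBracket (𝓡 4) Y Z := by
    filter_upwards [hf', hZ.eventually_isDiffAt] with y h1 h2
    rw [mlieBracket_smul_right h1 h2]
    rfl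
  have hYf := IsSmoothAt.mvfderiv_apply hf hY
  have hYZ := hY.mlieBracket hZ
  rw [(Filter.EventuallyEq.refl _ X).mlieBracket_vectorField_eq h,
    mlieBracket_add_right (hZ.smul hYf).isDiffAt (hYZ.smul hf).isDiffAt,
    mlieBracket_smul_right (hYf.mdifferentiableAt (by simp)) hZ.isDiffAt,
    mlieBracket_smul_right (hf.mdifferentiableAt (by simp)) hYZ.isDiffAt]

/-- The Lie bracket acts on functions as the commutator of derivations. -/
lemma mvfderiv_mlieBracket {f : M → ℝ} (hf : ContMDiffAt (𝓡 4) 𝓘(ℝ) ∞ f x)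
    (hX : IsSmoothAt X x) (hY : IsSmoothAt Y x) :
    mvfderiv (𝓡 4) f x (mlieBracket (𝓡 4) X Y x) =
      mvfderiv (𝓡 4) (fun y ↦ mvfderiv (𝓡 4) f y (Y y)) x (X x) -
        mvfderiv (𝓡 4) (fun y ↦ mvfderiv (𝓡 4) f y (X y)) x (Y x) := by
  let b : Module.Basis (Fin 4) ℝ (TangentSpace (𝓡 4) x) := Module.finBasisOfFinrankEq ℝ R4 (by simp)
  -- Only a nonzero tangent vector is needed: its coefficients will be compared.
  have hb : b 0 ≠ 0 := b.ne_zero 0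
  have hZ := isSmoothAt_extend (b 0)
  -- In the Jacobi identity for `X`, `Y`, `f • Z`, the first-order terms cancel and those with `f`
  -- undifferentiated cancel by the identity for `X`, `Y`, `Z`; the rest is the claim times `Z x`.
  have h := leibniz_mlieBracket hX hY (hZ.smul hf)
  rw [mlieBracket_mlieBracket_smul hf hY hZ, mlieBracket_mlieBracket_smul hf hX hZ,
    mlieBracket_smul_right (hf.mdifferentiableAt (by simp)) hZ.isDiffAt,
    leibniz_mlieBracket hX hY hZ, FiberBundle.extend_apply_self] at h
  refine smul_left_injective ℝ hb ?_
  simp only [smul_add, sub_smul] at h ⊢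
  rw [← sub_eq_zero] at h ⊢
  rw [← neg_eq_zero, ← h]
  abel

variable (g : LorentzianMetric M)

lemma mvfderiv_pair (hY : IsDiffAt Y x) (hZ : IsDiffAt Z x) (u : TangentSpace (𝓡 4) x) :
    mvfderiv (𝓡 4) (g.pair Y Z) x u =
      g.val x (g.leviCivita Y x u) (Z x) + g.val x (Y x) (g.leviCivita Z x u) := by
  have h := (g.leviCivita_spec (isSmoothAt_extend u).isDiffAt hY hZ).2
  rwa [FiberBundle.extend_apply_self] at h

lemma mlieBracket_eq (hX : IsDiffAt X x) (hY : IsDiffAt Y x) :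
    mlieBracket (𝓡 4) X Y x = g.nabla X Y x - g.nabla Y X x :=
  (g.leviCivita_spec hX hY hX).1.symm

/-- Metric compatibility used twice. The two mixed terms together are symmetric in `X` and `Y`, so
they vanish in a commutator. -/
lemma mvfderiv_mvfderiv_pair (hY : IsSmoothAt Y x) (hZ : IsSmoothAt Z x) (hW : IsSmoothAt W x) :
    mvfderiv (𝓡 4) (fun y ↦ mvfderiv (𝓡 4) (g.pair Z W) y (Y y)) x (X x) =
      (g.val x (g.nabla X (g.nabla Y Z) x) (W x) + g.val x (g.nabla Y Z x) (g.nabla X W x)) +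
      (g.val x (g.nabla X Z x) (g.nabla Y W x) + g.val x (Z x) (g.nabla X (g.nabla Y W) x)) := by
  have h : (fun y ↦ mvfderiv (𝓡 4) (g.pair Z W) y (Y y)) =ᶠ[𝓝 x]
      g.pair (g.nabla Y Z) W + g.pair Z (g.nabla Y W) := by
    filter_upwards [hZ.eventually_isDiffAt, hW.eventually_isDiffAt] with y h1 h2
    exact g.mvfderiv_pair h1 h2 _
  have hYZ := (hY.nabla g hZ).isDiffAt
  have hYW := (hY.nabla g hW).isDiffAt
  have h' : mvfderiv (𝓡 4) (fun y ↦ mvfderiv (𝓡 4) (g.pair Z W) y (Y y)) x =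
      mvfderiv (𝓡 4) (g.pair (g.nabla Y Z) W + g.pair Z (g.nabla Y W)) x :=
    mvfderiv_congr h
  rw [h', mvfderiv_add (g.mdifferentiableAt_pair hYZ hW.isDiffAt)
    (g.mdifferentiableAt_pair hZ.isDiffAt hYW), add_apply, g.mvfderiv_pair hYZ hW.isDiffAt,
    g.mvfderiv_pair hZ.isDiffAt hYW]
  rfl

/-- `R(X,Y)` is skew-adjoint. -/
lemma val_curvature_skew (hX : IsSmoothAt X x) (hY : IsSmoothAt Y x) (hZ : IsSmoothAt Z x)
    (hW : IsSmoothAt W x) :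
    g.val x (g.curvature X Y Z x) (W x) = - g.val x (Z x) (g.curvature X Y W x) := by
  -- The operator `XY - YX - [X,Y]` annihilates the function `g(Z,W)`; expanded by metric
  -- compatibility, this is skew-adjointness.
  have h := mvfderiv_mlieBracket (g.contMDiffAt_pair hZ hW) hX hY
  rw [g.mvfderiv_mvfderiv_pair hY hZ hW, g.mvfderiv_mvfderiv_pair hX hZ hW,
    g.mvfderiv_pair hZ.isDiffAt hW.isDiffAt] at h
  simp only [curvature, Pi.sub_apply, map_sub, sub_apply] at h ⊢
  simp only [nabla] at h ⊢
  linarith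

/-- The curvature at a point depends only on the value of its last argument there. -/
lemma curvature_congr_right (hX : IsSmoothAt X x) (hY : IsSmoothAt Y x) (hZ : IsSmoothAt Z x)
    (hW : IsSmoothAt W x) (h : Z x = W x) : g.curvature X Y Z x = g.curvature X Y W x := by
  refine g.eq_of_forall_val_eq fun w ↦ ?_
  -- Skew-adjointness moves the curvature onto the test field, leaving the last argument
  -- undifferentiated.
  have hE := isSmoothAt_extend w
  have h1 := g.val_curvature_skew hX hY hZ hE
  have h2 := g.val_curvature_skew hX hY hW hE
  rw [FiberBundle.extend_apply_self] at h1 h2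
  rw [h1, h2, h]

lemma leviCivita_add (hX : IsDiffAt X x) (hY : IsDiffAt Y x) :
    g.leviCivita (X + Y) x = g.leviCivita X x + g.leviCivita Y x :=
  g.leviCivita.isCovariantDerivativeOnUniv.add hX hY

lemma leviCivita_smul {f : M → ℝ} (hf : MDifferentiableAt (𝓡 4) 𝓘(ℝ) f x) (hX : IsDiffAt X x)
    (u : TangentSpace (𝓡 4) x) :
    g.leviCivita (f • X) x u = f x • g.leviCivita X x u + mvfderiv (𝓡 4) f x u • X x := by
  rw [g.leviCivita.isCovariantDerivativeOnUniv.leibniz hX hf]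
  rfl

lemma leviCivita_sub (hX : IsDiffAt X x) (hY : IsDiffAt Y x) :
    g.leviCivita (X - Y) x = g.leviCivita X x - g.leviCivita Y x := by
  have h := g.leviCivita_add (mdifferentiableAt_sub_section hX hY) hY
  rw [sub_add_cancel] at h
  rw [h, add_sub_cancel_right]

end LorentzianMetric

namespace LorentzianMetric

variable {M : Type*} [TopologicalSpace M] [ChartedSpace R4 M] [IsManifold (𝓡 4) ∞ M]
variable {g : LorentzianMetric M} {X Y Z ξ V : Π x : M, TangentSpace (𝓡 4) x} {x : M}

/-! ### Torse-forming unit fields -/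

lemma IsTorseForming.nabla_eq (h : g.IsTorseForming ξ) (X : Π x : M, TangentSpace (𝓡 4) x) :
    g.nabla X ξ = X + g.pair X ξ • ξ :=
  funext fun y ↦ h y (X y)

lemma IsTorseForming.nabla_self (h : g.IsTorseForming ξ)
    (hunit : ∀ x, g.val x (ξ x) (ξ x) = -1) : g.nabla ξ ξ = 0 := by
  funext y
  rw [h.nabla_eq]
  simp [pair, hunit]

lemma IsTorseForming.curvature_eq (h : g.IsTorseForming ξ) (hξ : IsSmoothAt ξ x)
    (hX : IsSmoothAt X x) (hY : IsSmoothAt Y x) :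
    g.curvature X Y ξ x = g.val x (Y x) (ξ x) • X x - g.val x (X x) (ξ x) • Y x := by
  -- This is `∇_A ∇_B ξ`. After antisymmetrization the terms symmetric in `A`, `B` drop out, and
  -- those with `∇_A B` cancel against the bracket term by vanishing torsion; only `η(B)A`
  -- contributes.
  have aux {A B : Π x : M, TangentSpace (𝓡 4) x} (hB : IsSmoothAt B x) :
      g.nabla A (B + g.pair B ξ • ξ) x = g.nabla A B x +
        (g.val x (B x) (ξ x) • (A x + g.val x (A x) (ξ x) • ξ x) +
        (g.val x (g.nabla A B x) (ξ x) + (g.val x (B x) (A x) +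
          g.val x (A x) (ξ x) * g.val x (B x) (ξ x))) • ξ x) := by
    have hp := g.mdifferentiableAt_pair hB.isDiffAt hξ.isDiffAt
    unfold nabla
    rw [g.leviCivita_add hB.isDiffAt (hξ.smul (g.contMDiffAt_pair hB hξ)).isDiffAt,
      add_apply, g.leviCivita_smul hp hξ.isDiffAt, h,
      g.mvfderiv_pair hB.isDiffAt hξ.isDiffAt, h]
    simp [pair]
  simp only [curvature, Pi.sub_apply]
  rw [h.nabla_eq, h.nabla_eq, h.nabla_eq, aux hY, aux hX]
  simp only [Pi.add_apply, Pi.smul_apply', pair, g.mlieBracket_eq hX.isDiffAt hY.isDiffAt,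
    map_sub, sub_apply, g.symm x (Y x) (X x)]
  module

lemma IsTorseForming.riemann_eq (h : g.IsTorseForming ξ) (hξ : IsSmoothAt ξ x)
    (u v : TangentSpace (𝓡 4) x) :
    g.riemann x u v (ξ x) = g.val x v (ξ x) • u - g.val x u (ξ x) • v := by
  unfold riemann
  rw [g.curvature_congr_right (isSmoothAt_extend u) (isSmoothAt_extend v)
    (isSmoothAt_extend (ξ x)) hξ (FiberBundle.extend_apply_self ..),
    h.curvature_eq hξ (isSmoothAt_extend u) (isSmoothAt_extend v)]
  simp only [FiberBundle.extend_apply_self]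

/-- The trace of `u ↦ η(v)u - η(u)v` in dimension four is `4η(v) - η(v)`. -/
lemma IsTorseForming.ricci_eq (h : g.IsTorseForming ξ) (hξ : IsSmoothAt ξ x)
    (v : TangentSpace (𝓡 4) x) : g.ricci x v (ξ x) = 3 * g.val x v (ξ x) := by
  have h1 : ∑ i, (g.frame x).repr v i * g.val x (g.frame x i) (ξ x) = g.val x v (ξ x) := by
    conv_rhs => rw [← (g.frame x).sum_repr v]
    simp only [map_sum, map_smul, sum_apply, smul_apply, smul_eq_mul]
  unfold ricci
  simp only [h.riemann_eq hξ, map_sub, map_smul, Finsupp.sub_apply, Finsupp.smul_apply,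
    Module.Basis.repr_self, Finsupp.single_eq_same, smul_eq_mul, mul_one,
    Finset.sum_sub_distrib, Finset.sum_const, Finset.card_univ, Fintype.card_fin, nsmul_eq_mul]
  rw [← h1]
  simp only [mul_comm]
  push_cast
  ring

/-! ### Ricci solitons with a torse-forming unit field -/

section Soliton

variable {Λ : ℝ}

/-- For a metric torsion-free connection `(L_V g)(u,ξ)` is the left-hand side; the constant collects
`2S(u,ξ) = 6η(u)` and `2Λη(u)`. -/
lemma IsRicciSoliton.val_nabla (hs : g.IsRicciSoliton V Λ) (h : g.IsTorseForming ξ)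
    (hξ : IsSmoothAt ξ x) (hV : IsSmoothAt V x) (u : TangentSpace (𝓡 4) x) :
    g.val x (g.leviCivita V x u) (ξ x) + g.val x u (g.nabla ξ V x) =
      -(6 + 2 * Λ) * g.val x u (ξ x) := by
  have hU := (isSmoothAt_extend u).isDiffAt
  have h1 := hs _ _ x hU hξ.isDiffAt
  rw [h.ricci_eq hξ, lieDerivMetric, g.mvfderiv_pair hU hξ.isDiffAt,
    g.mlieBracket_eq hV.isDiffAt hU, g.mlieBracket_eq hV.isDiffAt hξ.isDiffAt] at h1
  simp only [nabla, map_sub, sub_apply, FiberBundle.extend_apply_self] at h1 ⊢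
  linarith

lemma IsTorseForming.mvfderiv_pair_apply (h : g.IsTorseForming ξ)
    (hξ : IsSmoothAt ξ x) (hV : IsSmoothAt V x) (u : TangentSpace (𝓡 4) x) :
    mvfderiv (𝓡 4) (g.pair V ξ) x u = g.val x (g.leviCivita V x u) (ξ x) +
      (g.val x u (V x) + g.val x u (ξ x) * g.pair V ξ x) := by
  rw [g.mvfderiv_pair hV.isDiffAt hξ.isDiffAt, h]
  simp [pair, g.symm x (V x) u]

/-- Trading `g(∇_u V, ξ)` for the derivative of `φ = g(V,ξ)` turns the soliton equation into a
formula for `∇_ξ V` alone. -/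
lemma IsRicciSoliton.val_nabla_eq (hs : g.IsRicciSoliton V Λ) (h : g.IsTorseForming ξ)
    (hξ : IsSmoothAt ξ x) (hV : IsSmoothAt V x) (u : TangentSpace (𝓡 4) x) :
    g.val x u (g.nabla ξ V x) = -(6 + 2 * Λ) * g.val x u (ξ x) - mvfderiv (𝓡 4) (g.pair V ξ) x u +
      g.val x u (V x) + g.val x u (ξ x) * g.pair V ξ x := by
  have h1 := hs.val_nabla h hξ hV u
  have h2 := h.mvfderiv_pair_apply hξ hV u
  linarith

lemma IsRicciSoliton.mvfderiv_pair_self (hs : g.IsRicciSoliton V Λ) (h : g.IsTorseForming ξ)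
    (hunit : ∀ x, g.val x (ξ x) (ξ x) = -1) (hξ : IsSmoothAt ξ x) (hV : IsSmoothAt V x) :
    mvfderiv (𝓡 4) (g.pair V ξ) x (ξ x) = 3 + Λ := by
  have h1 := hs.val_nabla h hξ hV (ξ x)
  have h2 := h.mvfderiv_pair_apply hξ hV (ξ x)
  rw [g.symm x _ (ξ x)] at h1 h2
  rw [hunit] at h1 h2
  have h3 : g.pair V ξ x = g.val x (ξ x) (V x) := g.symm x _ _
  simp only [nabla] at h1
  linarith

lemma IsRicciSoliton.nabla_nabla_eq (hs : g.IsRicciSoliton V Λ) (h : g.IsTorseForming ξ)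
    (hunit : ∀ x, g.val x (ξ x) (ξ x) = -1) (hξ : ∀ y, IsSmoothAt ξ y) (hV : ∀ y, IsSmoothAt V y) (x : M) :
    g.nabla ξ (g.nabla ξ V) x = V x + g.pair V ξ x • ξ x := by
  refine g.eq_of_forall_val_eq fun w ↦ ?_
  set Z : Π x : M, TangentSpace (𝓡 4) x := FiberBundle.extend R4 w
  have hZ : IsSmoothAt Z x := isSmoothAt_extend w
  have hZx : Z x = w := FiberBundle.extend_apply_self ..
  have hA : IsSmoothAt (g.nabla ξ V) x := (hξ x).nabla g (hV x)
  have hφ : ContMDiffAt (𝓡 4) 𝓘(ℝ) ∞ (g.pair V ξ) x := g.contMDiffAt_pair (hV x) (hξ x)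
  have hZφ := IsSmoothAt.mvfderiv_apply hφ hZ
  have hZξ := g.contMDiffAt_pair hZ (hξ x)
  have d {f : M → ℝ} (hf : ContMDiffAt (𝓡 4) 𝓘(ℝ) ∞ f x) : MDifferentiableAt (𝓡 4) 𝓘(ℝ) f x :=
    hf.mdifferentiableAt (by simp)
  -- The formula for `∇_ξ V`, tested against a field `Z` so that it can be differentiated along `ξ`
  -- as an identity of functions; no gradient field is introduced.
  have hpair : g.pair Z (g.nabla ξ V) =
      (fun _ ↦ -(6 + 2 * Λ)) * g.pair Z ξ + - (fun y ↦ mvfderiv (𝓡 4) (g.pair V ξ) y (Z y)) +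
        g.pair Z V + g.pair Z ξ * g.pair V ξ :=
    funext fun y ↦ by
      simpa [sub_eq_add_neg, pair] using hs.val_nabla_eq h (hξ y) (hV y) (Z y)
  have hdA := congrArg (fun f ↦ mvfderiv (𝓡 4) f x (ξ x)) hpair
  have hself : (fun y ↦ mvfderiv (𝓡 4) (g.pair V ξ) y (ξ y)) = fun _ ↦ 3 + Λ :=
    funext fun y ↦ hs.mvfderiv_pair_self h hunit (hξ y) (hV y)
  -- Evaluates `ξ(Zφ)`: the term `Z(ξφ)` vanishes because `ξφ` is constant, and `[ξ,Z] = ∇_ξ Z - Z -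
  -- η(Z)ξ`.
  have hcomm := mvfderiv_mlieBracket hφ (hξ x) hZ
  rw [hself, mvfderiv_const, g.mlieBracket_eq (hξ x).isDiffAt hZ.isDiffAt, h.nabla_eq] at hcomm
  -- Applied to `∇_ξ Z`, the formula cancels every term that depends on how `w` was extended;
  -- applied to `Z` in the next line, it removes the remaining `Zφ`.
  have hval := hs.val_nabla_eq h (hξ x) (hV x) (g.nabla ξ Z x)
  have hval' := hs.val_nabla_eq h (hξ x) (hV x) (Z x)
  have hself' := hs.mvfderiv_pair_self h hunit (hξ x) (hV x)
  have hnξ : g.leviCivita ξ x (ξ x) = 0 := congrFun (h.nabla_self hunit) x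
  have d1 : MDifferentiableAt (𝓡 4) 𝓘(ℝ) (fun _ : M ↦ -(6 + 2 * Λ)) x := mdifferentiableAt_const
  have d2 : MDifferentiableAt (𝓡 4) 𝓘(ℝ) (-fun y ↦ mvfderiv (𝓡 4) (g.pair V ξ) y (Z y)) x :=
    (d hZφ).neg
  have d3 := d (g.contMDiffAt_pair hZ (hV x))
  have d4 := d1.mul (d hZξ)
  rw [g.mvfderiv_pair hZ.isDiffAt hA.isDiffAt,
    mvfderiv_add ((d4.add d2).add d3) ((d hZξ).mul (d hφ)), mvfderiv_add (d4.add d2) d3,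
    mvfderiv_add d4 d2, mvfderiv_mul d1 (d hZξ), mvfderiv_mul (d hZξ) (d hφ),
    mvfderiv_const, mvfderiv_neg] at hdA
  simp only [add_apply, smul_apply, neg_apply, smul_zero, add_zero, smul_eq_mul,
    g.mvfderiv_pair hZ.isDiffAt (hξ x).isDiffAt, g.mvfderiv_pair hZ.isDiffAt (hV x).isDiffAt,
    hself', hnξ, map_zero] at hdA
  simp only [Pi.add_apply, Pi.smul_apply', map_sub, map_add, map_smul, smul_eq_mul, hself',
    zero_apply, sub_zero] at hcomm
  rw [g.symm x _ w, ← hZx, g.symm x (V x + _)]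
  simp only [map_add, map_smul, smul_eq_mul]
  simp only [nabla, pair] at *
  linarith

theorem IsRicciSoliton.jacobi_equation (hs : g.IsRicciSoliton V Λ) (h : g.IsTorseForming ξ)
    (hunit : ∀ x, g.val x (ξ x) (ξ x) = -1) (hξ : ∀ y, IsSmoothAt ξ y) (hV : ∀ y, IsSmoothAt V y) (x : M) :
    g.nabla ξ (g.nabla ξ V) x + g.riemann x (V x) (ξ x) (ξ x) = 0 := by
  rw [hs.nabla_nabla_eq h hunit hξ hV, h.riemann_eq (hξ x), hunit, pair]
  module

theorem IsRicciSoliton.lieDerivConnection_eq_zero (hs : g.IsRicciSoliton V Λ)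
    (h : g.IsTorseForming ξ) (hunit : ∀ x, g.val x (ξ x) (ξ x) = -1)
    (hξ : ∀ y, IsSmoothAt ξ y) (hV : ∀ y, IsSmoothAt V y) (x : M) :
    g.lieDerivConnection V ξ ξ x = 0 := by
  have hA : IsSmoothAt (g.nabla ξ V) x := (hξ x).nabla g (hV x)
  have hφ : ContMDiffAt (𝓡 4) 𝓘(ℝ) ∞ (g.pair V ξ) x := g.contMDiffAt_pair (hV x) (hξ x)
  have hB : mlieBracket (𝓡 4) V ξ = V + g.pair V ξ • ξ - g.nabla ξ V :=
    funext fun y ↦ by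
      rw [g.mlieBracket_eq (hV y).isDiffAt (hξ y).isDiffAt, h.nabla_eq]
      rfl
  have hAξ : g.val x (g.nabla ξ V x) (ξ x) = 3 + Λ := by
    have h1 := hs.val_nabla h (hξ x) (hV x) (ξ x)
    rw [hunit, g.symm x (ξ x)] at h1
    simp only [nabla] at h1 ⊢
    linarith
  have h2 := hs.nabla_nabla_eq h hunit hξ hV x
  have h3 := hs.mvfderiv_pair_self h hunit (hξ x) (hV x)
  have h4 : g.leviCivita ξ x (ξ x) = 0 := congrFun (h.nabla_self hunit) x
  have h5 : g.nabla ξ (V + g.pair V ξ • ξ - g.nabla ξ V) x =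
      g.nabla ξ V x + (3 + Λ) • ξ x - (V x + g.pair V ξ x • ξ x) := by
    rw [← h2]
    unfold nabla at hA ⊢
    rw [g.leviCivita_sub ((hV x).add ((hξ x).smul hφ)).isDiffAt hA.isDiffAt,
      g.leviCivita_add (hV x).isDiffAt ((hξ x).smul hφ).isDiffAt, sub_apply, add_apply,
      g.leviCivita_smul (hφ.mdifferentiableAt (by simp)) (hξ x).isDiffAt, h3, h4]
    simp
  simp only [lieDerivConnection, Pi.sub_apply]
  -- With `∇_ξ ξ = 0` only `-∇_B ξ - ∇_ξ B` is left, for `B = [V,ξ]`. Here `η(B) = -(3+Λ)`, so the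
  -- two terms are opposite.
  rw [h.nabla_self hunit, mlieBracket_zero_right, hB, h5, h.nabla_eq]
  simp only [Pi.zero_apply, Pi.add_apply, Pi.sub_apply, Pi.smul_apply', pair, map_sub, map_add,
    map_smul, sub_apply, add_apply, smul_apply, hunit, hAξ, smul_eq_mul]
  module

end Soliton

end LorentzianMetric

namespace LorentzianMetric

variable {M : Type*} [TopologicalSpace M] [ChartedSpace R4 M] [IsManifold (𝓡 4) ∞ M]
variable {g : LorentzianMetric M} {X Y W ξ V : Π x : M, TangentSpace (𝓡 4) x} {x : M}
variable {γ : ℝ → M} {s : Set ℝ} {t : ℝ}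

/-! ### Covariant differentiation along curves -/

lemma leviCivita_sum_smul {ι : Type*} (S : Finset ι) {f : ι → M → ℝ}
    {E : ι → Π x : M, TangentSpace (𝓡 4) x}
    (hf : ∀ i, MDifferentiableAt (𝓡 4) 𝓘(ℝ) (f i) x) (hE : ∀ i, IsDiffAt (E i) x)
    (u : TangentSpace (𝓡 4) x) :
    IsDiffAt (∑ i ∈ S, f i • E i) x ∧ g.leviCivita (∑ i ∈ S, f i • E i) x u =
      ∑ i ∈ S, (f i x • g.leviCivita (E i) x u + mvfderiv (𝓡 4) (f i) x u • E i x) := by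
  classical
  induction S using Finset.induction_on with
  | empty =>
    refine ⟨mdifferentiable_zeroSection .., ?_⟩
    rw [Finset.sum_empty, g.leviCivita.zero]
    simp
  | insert i S hi ih =>
    have h1 : IsDiffAt (f i • E i) x := (hf i).smul_section (hE i)
    rw [Finset.sum_insert hi, Finset.sum_insert hi, ← ih.2, g.leviCivita_add h1 ih.1, add_apply,
      g.leviCivita_smul (hf i) (hE i)]
    exact ⟨mdifferentiableAt_add_section h1 ih.1, rfl⟩

/-- The covariant derivative of a vector field in terms of its components in the trivialization. -/
lemma leviCivita_apply_eq (hW : IsDiffAt W x) (u : TangentSpace (𝓡 4) x) :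
    g.leviCivita W x u = g.leviCivita (FiberBundle.extend R4 (W x)) x u +
      ∑ i, mvfderiv (𝓡 4) (fun y ↦ (trivializationAt R4 (TangentSpace (𝓡 4) : M → Type) x
        (TotalSpace.mk' R4 y (W y))).2 i) x u • coordField x i x := by
  let T := trivializationAt R4 (TangentSpace (𝓡 4) : M → Type) x
  have hx : x ∈ T.baseSet := FiberBundle.mem_baseSet_trivializationAt' x
  have hT : ∀ᶠ y in 𝓝 x, y ∈ T.baseSet := T.open_baseSet.mem_nhds hx
  have hE i : IsDiffAt (coordField x i) x := (isSmoothAt_extend _).isDiffAt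
  have hext := (isSmoothAt_extend (W x)).isDiffAt
  have hWT : MDifferentiableAt (𝓡 4) 𝓘(ℝ, R4) (fun y ↦ (T ⟨y, W y⟩).2) x :=
    (mdifferentiableAt_section ..).1 hW
  have hf i : MDifferentiableAt (𝓡 4) 𝓘(ℝ) (fun y ↦ (T ⟨y, W y⟩).2 i) x :=
    ((EuclideanSpace.proj i : R4 →L[ℝ] ℝ).mdifferentiableAt).comp x hWT
  have h1 := leviCivita_sum_smul (g := g) Finset.univ hf hE u
  have h2 := leviCivita_sum_smul (g := g) Finset.univ (f := fun i _ ↦ (T ⟨x, W x⟩).2 i)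
    (fun i ↦ mdifferentiableAt_const) hE u
  -- Near the point, `W` and the extension of its value are combinations of the same coordinate
  -- fields, with variable and with constant coefficients; by the Leibniz rule their covariant
  -- derivatives differ by the derivatives of the coefficients.
  have h3 : g.leviCivita W x =
      g.leviCivita (∑ i : Fin 4, (fun y : M ↦ (T ⟨y, W y⟩).2 i) • coordField x i) x := by
    refine g.leviCivita.isCovariantDerivativeOnUniv.congr_of_eventuallyEq hW h1.1
      Filter.univ_mem ?_
    filter_upwards [hT] with y hy
    have h := symmL_eq_sum_coordField hy (T ⟨y, W y⟩).2
    rw [T.symmL_apply hy, T.symm_apply_apply_mk hy] at h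
    simpa [Finset.sum_apply] using h
  have h4 : g.leviCivita (FiberBundle.extend R4 (W x)) x =
      g.leviCivita (∑ i : Fin 4, (fun _ : M ↦ (T ⟨x, W x⟩).2 i) • coordField x i) x := by
    refine g.leviCivita.isCovariantDerivativeOnUniv.congr_of_eventuallyEq hext h2.1
      Filter.univ_mem ?_
    filter_upwards [hT] with y hy
    have h := symmL_eq_sum_coordField hy (T ⟨x, W x⟩).2
    rw [T.symmL_apply hy] at h
    simpa [Finset.sum_apply, FiberBundle.extend] using h
  rw [h3, h4, h1.2, h2.2]
  simp only [mvfderiv_const, zero_apply, zero_smul, add_zero, Finset.sum_add_distrib]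
  rfl

/-- The covariant derivative along `γ` of the restriction of a vector field. -/
lemma covDerivAlong_comp (hγ : MDifferentiableAt 𝓘(ℝ, ℝ) (𝓡 4) γ t) (hW : IsDiffAt W (γ t)) :
    g.covDerivAlong γ (fun r ↦ W (γ r)) t = g.leviCivita W (γ t) (velocity γ t) := by
  let T := trivializationAt R4 (TangentSpace (𝓡 4) : M → Type) (γ t)
  have hx : γ t ∈ T.baseSet := FiberBundle.mem_baseSet_trivializationAt' (γ t)
  have hWT : MDifferentiableAt (𝓡 4) 𝓘(ℝ, R4) (fun y ↦ (T ⟨y, W y⟩).2) (γ t) :=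
    (mdifferentiableAt_section ..).1 hW
  have hd : DifferentiableAt ℝ (fun r ↦ (T ⟨γ r, W (γ r)⟩).2) t :=
    mdifferentiableAt_iff_differentiableAt.1 (hWT.comp t hγ)
  -- Chain rule for each component; it matches the coefficient derivatives of `leviCivita_apply_eq`
  -- with the ordinary derivative in `covDerivAlong`.
  have key i : mvfderiv (𝓡 4) (fun y ↦ (T ⟨y, W y⟩).2 i) (γ t) (velocity γ t) =
      deriv (fun r ↦ (T ⟨γ r, W (γ r)⟩).2) t i := by
    have hf : MDifferentiableAt (𝓡 4) 𝓘(ℝ) (fun y ↦ (T ⟨y, W y⟩).2 i) (γ t) :=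
      ((EuclideanSpace.proj i : R4 →L[ℝ] ℝ).mdifferentiableAt).comp (γ t) hWT
    have h1 := mvfderiv_comp_apply t hf hγ (1 : ℝ)
    have h2 : HasDerivAt (fun r ↦ (T ⟨γ r, W (γ r)⟩).2 i)
        (deriv (fun r ↦ (T ⟨γ r, W (γ r)⟩).2) t i) t :=
      (EuclideanSpace.proj i : R4 →L[ℝ] ℝ).hasFDerivAt.comp_hasDerivAt t hd.hasDerivAt
    rw [← h2.deriv]
    refine h1.symm.trans ?_
    change mfderiv 𝓘(ℝ, ℝ) 𝓘(ℝ, ℝ) (fun r ↦ (T ⟨γ r, W (γ r)⟩).2 i) t (1 : ℝ) = _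
    rw [mfderiv_eq_fderiv]
    rfl
  rw [leviCivita_apply_eq hW, covDerivAlong, add_comm]
  congr 1
  have h := symmL_eq_sum_coordField hx (deriv (fun r ↦ (T ⟨γ r, W (γ r)⟩).2) t)
  rw [T.symmL_apply hx] at h
  refine h.trans (Finset.sum_congr rfl fun i _ ↦ ?_)
  rw [← key i]

lemma covDerivAlong_congr {J J' : Π t : ℝ, TangentSpace (𝓡 4) (γ t)}
    (h : ∀ᶠ r in 𝓝 t, J r = J' r) : g.covDerivAlong γ J t = g.covDerivAlong γ J' t := by
  unfold covDerivAlong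
  rw [h.self_of_nhds]
  congr 2
  refine Filter.EventuallyEq.deriv_eq (h.mono fun r hr ↦ ?_)
  simp only [hr]

/-! ### Integral curves -/

/-- Bootstrapping: in the chart at `γ t` the derivative of the curve is the component vector of `ξ`
along `γ`, which is as regular as `γ`, so `γ` gains one order. -/
lemma contMDiffAt_integralCurve_succ {n : ℕ} (hξ : IsSmoothAt ξ (γ t))
    (h : IsMIntegralCurveAt γ ξ t) (hn : ContMDiffAt 𝓘(ℝ, ℝ) (𝓡 4) n γ t) :
    ContMDiffAt 𝓘(ℝ, ℝ) (𝓡 4) (n + 1 : ℕ) γ t := by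
  let T := trivializationAt R4 (TangentSpace (𝓡 4) : M → Type) (γ t)
  have hF : ContMDiffAt (𝓡 4) 𝓘(ℝ, R4) n (fun y ↦ (T ⟨y, ξ y⟩).2) (γ t) :=
    ((contMDiffAt_section ..).1 hξ).of_le (mod_cast le_top)
  have hFγ : ContDiffAt ℝ n (fun r ↦ (T ⟨γ r, ξ (γ r)⟩).2) t :=
    (hF.comp t hn).contDiffAt
  rw [contMDiffAt_iff_target]
  refine ⟨hn.continuousAt, ContDiffAt.contMDiffAt ?_⟩
  refine contDiffAt_succ_iff_hasFDerivAt.2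
    ⟨fun r ↦ (1 : ℝ →L[ℝ] ℝ).smulRight (T ⟨γ r, ξ (γ r)⟩).2, ?_, ?_⟩
  · have h1 := h.eventually_hasDerivAt
    exact ⟨_, h1, fun r hr ↦ hr.hasFDerivAt⟩
  · exact contDiffAt_const.smulRight hFγ

/-- Integral curves of smooth vector fields are smooth. -/
lemma contMDiffOn_integralCurve (hξ : ∀ y, IsSmoothAt ξ y) (hs : IsOpen s)
    (h : IsMIntegralCurveOn γ ξ s) : ContMDiffOn 𝓘(ℝ, ℝ) (𝓡 4) ∞ γ s := by
  have key (n : ℕ) : ∀ t ∈ s, ContMDiffAt 𝓘(ℝ, ℝ) (𝓡 4) n γ t := by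
    induction n with
    | zero =>
      intro t ht
      refine (contMDiffOn_zero_iff.2 h.continuousOn).contMDiffAt (hs.mem_nhds ht)
    | succ n ih =>
      exact fun t ht ↦ contMDiffAt_integralCurve_succ (hξ _)
        (h.isMIntegralCurveAt (hs.mem_nhds ht)) (ih t ht)
  exact contMDiffOn_infty.2 fun n t ht ↦ (key n t ht).contMDiffWithinAt

omit [IsManifold (𝓡 4) ∞ M] in
lemma velocity_integralCurve (hs : IsOpen s) (h : IsMIntegralCurveOn γ ξ s) (ht : t ∈ s) :
    velocity γ t = ξ (γ t) := by
  unfold velocity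
  rw [((h t ht).hasMFDerivAt (hs.mem_nhds ht)).mfderiv]
  exact one_smul ℝ (ξ (γ t))

lemma covDerivAlong_integralCurve (hs : IsOpen s) (h : IsMIntegralCurveOn γ ξ s) (ht : t ∈ s)
    (hW : IsDiffAt W (γ t)) :
    g.covDerivAlong γ (fun r ↦ W (γ r)) t = g.nabla ξ W (γ t) := by
  rw [covDerivAlong_comp ((h t ht).hasMFDerivAt (hs.mem_nhds ht)).mdifferentiableAt hW,
    velocity_integralCurve hs h ht]
  rfl

/-- Integral curves of an autoparallel smooth field are geodesics. -/
lemma isGeodesicOn_integralCurve (hξ : ∀ y, IsSmoothAt ξ y) (hξξ : g.nabla ξ ξ = 0)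
    (hs : IsOpen s) (h : IsMIntegralCurveOn γ ξ s) : g.IsGeodesicOn γ s := by
  refine ⟨contMDiffOn_integralCurve hξ hs h, fun t ht ↦ ?_⟩
  have h1 : ∀ᶠ r in 𝓝 t, velocity γ r = ξ (γ r) := by
    filter_upwards [hs.mem_nhds ht] with r hr using velocity_integralCurve hs h hr
  rw [covDerivAlong_congr h1, covDerivAlong_integralCurve hs h ht (hξ _).isDiffAt, hξξ]
  rfl

lemma isJacobiFieldOn_integralCurve (hξ : ∀ y, IsSmoothAt ξ y) (hV : ∀ y, IsSmoothAt V y)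
    (hJ : ∀ x, g.nabla ξ (g.nabla ξ V) x + g.riemann x (V x) (ξ x) (ξ x) = 0)
    (hs : IsOpen s) (h : IsMIntegralCurveOn γ ξ s) :
    g.IsJacobiFieldOn γ (fun t ↦ V (γ t)) s := by
  refine ⟨ContMDiff.comp_contMDiffOn hV (contMDiffOn_integralCurve hξ hs h), fun t ht ↦ ?_⟩
  -- The first derivative must be identified on a neighbourhood of `t`, not only at `t`, before
  -- differentiating again; openness of `s` provides it.
  have h1 : ∀ᶠ r in 𝓝 t, g.covDerivAlong γ (fun r ↦ V (γ r)) r = g.nabla ξ V (γ r) := by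
    filter_upwards [hs.mem_nhds ht] with r hr
      using covDerivAlong_integralCurve hs h hr (hV _).isDiffAt
  rw [covDerivAlong_congr h1,
    covDerivAlong_integralCurve hs h ht ((hξ _).nabla g (hV _)).isDiffAt,
    velocity_integralCurve hs h ht]
  exact hJ (γ t)

end LorentzianMetric

theorem mainTheorem6 {M : Type*} [TopologicalSpace M] [T2Space M] [SecondCountableTopology M]
    [ConnectedSpace M] [ChartedSpace R4 M] [IsManifold (𝓡 4) ∞ M]
    (g : LorentzianMetric M) (ξ V : Π x : M, TangentSpace (𝓡 4) x)
    (hξ : LorentzianMetric.IsSmoothField ξ) (hV : LorentzianMetric.IsSmoothField V)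
    (ρ σ : M → ℝ) (lam κ Λ : ℝ)
    (hfluid : g.IsPerfectFluid ξ ρ σ lam κ)
    (htorse : g.IsTorseForming ξ)
    (hsoliton : g.IsRicciSoliton V Λ) :
    (∀ x, g.lieDerivConnection V ξ ξ x = 0) ∧
    (∀ x, g.nabla ξ (g.nabla ξ V) x + g.riemann x (V x) (ξ x) (ξ x) = 0) ∧
    ∀ (γ : ℝ → M) (s : Set ℝ), IsOpen s → IsMIntegralCurveOn γ ξ s →
      g.IsGeodesicOn γ s ∧ g.IsJacobiFieldOn γ (fun t ↦ V (γ t)) s := by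
  have hJ := hsoliton.jacobi_equation htorse hfluid.1 hξ hV
  exact ⟨hsoliton.lieDerivConnection_eq_zero htorse hfluid.1 hξ hV, hJ, fun γ s hs h ↦
    ⟨LorentzianMetric.isGeodesicOn_integralCurve hξ (htorse.nabla_self hfluid.1) hs h,
      LorentzianMetric.isJacobiFieldOn_integralCurve hξ hV hJ hs h⟩⟩
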